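/- Let $K$ be a non-archimedean local field with ring of integers $\mathcal O_K$, residue field of cardinality $q$ and normalised discrete valuation $w\colon K^\times\to\mathbb Z$. Fix a Haar measure $dx$ on $K$, and let $\mathcal S(K)$ be the space of locally constant, compactly supported functions $K\to\mathbb C$. For a prime (uniformiser) $\pi$ of $K$ put $\nabla(x)=\pi^{w(x)}x$ for $x\ne 0$ and $\nabla(0)=0$, and for $g\colon K\to\mathbb C$ put $Wg(0)=g(0)$ and, for $x\neq0$, \[Wg(x)=\begin{cases} g(\pi^{-w(x)/2}x) & \text{if } w(x)\text{ is even},\\ g(\pi^{(-w(x)-1)/2}x) & \text{if } w(x)\text{ is odd.}\end{cases}\] Let $\psi\colon K\to S^1$ be a non-trivial continuous additive character. If $Wg$ is integrable, the $*$-transform of $g$ with respect to $\psi$ and $\pi$ is $g^*=\widehat{Wg}\circ\nabla$, where $\hat h(y)=\int_K h(x)\psi(xy)\,dx$. The conductor of $\psi$ is the integer $d$ such that $\psi$ is trivial on $\pi^d\mathcal O_K$ but not on $\pi^{d-1}\mathcal O_K$. For every prime $\pi$ and every $f\in\mathcal S(K)$, the function $Wf$ is integrable and $f^*\in\mathcal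 S(K)$, so that the double $*$-transform $f\mapsto f^{**}=(f^*)^*$ is a map $\mathcal S(K)\to\mathcal S(K)$. Moreover: 1. For fixed $\psi$, the double $*$-transform $f\mapsto f^{**}$ on $\mathcal S(K)$ does not depend on the choice of the prime $\pi$. 2. If $\psi$ has conductor $d$ and is replaced by another continuous additive character $\psi'$ of conductor $d'$ with $d'\equiv d\pmod 2$ (the Haar measure being kept fixed), then the double $*$-transform is multiplied by the constant $q^{d-d'}$; that is, the double $*$-transform of any $f\in\mathcal S(K)$ with respect to $\psi'$ equals $q^{d-d'}$ times the one with respect to $\psi$. -/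

import Mathlib

open MeasureTheory
open scoped ValuativeRel

namespace LocalField

noncomputable section

variable {K : Type*} [Field K] [ValuativeRel K] [TopologicalSpace K]
  [IsNonarchimedeanLocalField K]

/-- The normalised (surjective) discrete valuation `w : Kˣ → ℤ` of a non-archimedean local field,
extended by the harmless value `w 0 = 0`. -/
def w (x : K) : ℤ :=
  -WithZero.log
    (IsNonarchimedeanLocalField.valueGroupWithZeroIsoInt K (ValuativeRel.valuation K x))

/-- `π` is a prime (uniformiser) of `K`. -/
def IsPrimeElement (π : K) : Prop := w π = 1

/-- The fractional ideal `π ^ n 𝒪_K` (for any prime `π`). -/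
def fracIdeal (K : Type*) [Field K] [ValuativeRel K] [TopologicalSpace K]
    [IsNonarchimedeanLocalField K] (n : ℤ) : Set K := {x | x = 0 ∨ n ≤ w x}

/-- The additive character `ψ` has conductor `d`: it is trivial on `π ^ d 𝒪_K` but not on
`π ^ (d - 1) 𝒪_K`. -/
def HasConductor (ψ : AddChar K Circle) (d : ℤ) : Prop :=
  (∀ x ∈ fracIdeal K d, ψ x = 1) ∧ ∃ x ∈ fracIdeal K (d - 1), ψ x ≠ 1

/-- The Schwartz–Bruhat space `𝒮(K)`: locally constant functions of compact support. -/
def SchwartzBruhat (K : Type*) [TopologicalSpace K] : Set (K → ℂ) :=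
  {f | IsLocallyConstant f ∧ HasCompactSupport f}

/-- The map `∇ : K → K`, `x ↦ π ^ w(x) x`, `∇ 0 = 0`. -/
def nabla (π x : K) : K := π ^ w x * x

open Classical in
/-- The operator `W`: `W g x` is `g (π ^ (-w(x)/2) x)` if `w(x)` is even,
`g (π ^ ((-w(x)-1)/2) x)` if `w(x)` is odd, and `W g 0 = g 0`. The integer divisions are exact. -/
def W (π : K) (g : K → ℂ) (x : K) : ℂ :=
  if x = 0 then g 0
  else if Even (w x) then g (π ^ (-w x / 2) * x)
  else g (π ^ ((-w x - 1) / 2) * x)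

/-- The Fourier transform `ĝ(y) = ∫ g(x) ψ(x y) dx`. -/
def fourier [MeasurableSpace K] (μ : Measure K) (ψ : AddChar K Circle) (g : K → ℂ) (y : K) : ℂ :=
  ∫ x, g x * (ψ (x * y) : ℂ) ∂μ

/-- The `*`-transform `g* = (W g)^ ∘ ∇` with respect to the Haar measure `μ`, the additive
character `ψ` and the prime `π`. -/
def starTransform [MeasurableSpace K] (μ : Measure K) (ψ : AddChar K Circle) (π : K)
    (g : K → ℂ) : K → ℂ :=
  fun x => fourier μ ψ (W π g) (nabla π x)

/-- The double `*`-transform `g ↦ g**`. -/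
def doubleStarTransform [MeasurableSpace K] (μ : Measure K) (ψ : AddChar K Circle) (π : K)
    (g : K → ℂ) : K → ℂ :=
  starTransform μ ψ π (starTransform μ ψ π g)

end

end LocalField

/-! Write `|v| = q ^ (-w v)`. On the shells of valuation `2m` and `2m + 1`, `W f` is `f` on the
shell of valuation `m`, dilated by `π ^ m` and `π ^ (m + 1)`. Changing variables
(`integral_W_mul_eq`) makes the `*`-transform an integral operator, `f*(x) = ∫ f(v) |v| k(vx) dv`
with `k(t) = ψ(∇t) + q⁻¹ ψ(π∇t)`. Hence `f**(y)` integrates `f(v) |v|` against `∫ |x| k(vx) k(yx)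
dx`, once `x` is confined to a ball outside which `f*` vanishes.

The weight in `x` is invariant under units, so `k(vx) k(yx)` may be averaged over `x ↦ xu` with `u`
a unit. Since `∇(au) = ∇(a) u`, the product is a combination of four terms `ψ(su)` with `s = π ^ i
∇a + π ^ j ∇b` and `i, j ∈ {0, 1}`. The average of `ψ(su)` depends only on `w s` and the conductor,
and `w s` does not depend on `π`: the two terms have equal valuation only if `i = j` and `w a = w
b`, by parity, and then `s = π ^ (i + w a) (a + b)`. So `f**` depends on `ψ` and `π` only through
the conductor (`doubleStarTransform_eq_of_hasConductor`), which gives the first claim.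

For the second, `ψ'` may therefore be replaced by `ψ(π ^ (2e) ·)`, where `d - d' = 2e`. As `∇(π ^ e
x) = π ^ (2e) ∇x`, this dilates each `*`-transform by `π ^ e`. In the double transform the dilations
cancel and leave the factor `q ^ (2e)`. -/

namespace LocalField

/-! ### Valuation, balls, shells and the map `∇` -/

section Valuation

open Filter Topology

variable {K : Type*} [Field K] [ValuativeRel K] [TopologicalSpace K]
  [IsNonarchimedeanLocalField K]

theorem w_le_w_iff {x y : K} (hx : x ≠ 0) (hy : y ≠ 0) :
    w x ≤ w y ↔ ValuativeRel.valuation K y ≤ ValuativeRel.valuation K x := by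
  unfold w
  rw [neg_le_neg_iff, WithZero.log_le_log (by simpa using hy) (by simpa using hx)]
  exact map_le_map_iff (IsNonarchimedeanLocalField.valueGroupWithZeroIsoInt K)

@[simp] theorem w_zero : w (0 : K) = 0 := by simp [w]

@[simp] theorem w_one : w (1 : K) = 0 := by simp [w]

theorem w_mul {x y : K} (hx : x ≠ 0) (hy : y ≠ 0) : w (x * y) = w x + w y := by
  unfold w
  rw [map_mul, map_mul, WithZero.log_mul (by simpa using hx) (by simpa using hy)]
  ring

@[simp] theorem w_inv (x : K) : w x⁻¹ = -w x := by
  unfold w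
  rw [map_inv₀, map_inv₀, WithZero.log_inv]

@[simp] theorem w_pow (x : K) (n : ℕ) : w (x ^ n) = n * w x := by
  unfold w
  rw [map_pow, map_pow, WithZero.log_pow]
  simp

@[simp] theorem w_zpow (x : K) (n : ℤ) : w (x ^ n) = n * w x := by
  cases n with
  | ofNat n => simp
  | negSucc n => rw [zpow_negSucc, w_inv, w_pow, Int.negSucc_eq]; push_cast; ring

@[simp] theorem w_neg (x : K) : w (-x) = w x := by
  simp [w]

theorem IsPrimeElement.ne_zero {π : K} (hπ : IsPrimeElement π) : π ≠ 0 := by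
  rintro rfl
  simp [IsPrimeElement] at hπ

theorem IsPrimeElement.w_zpow_mul {π : K} (hπ : IsPrimeElement π) (n : ℤ) {x : K} (hx : x ≠ 0) :
    w (π ^ n * x) = n + w x := by
  rw [w_mul (zpow_ne_zero _ hπ.ne_zero) hx, w_zpow, hπ, mul_one]

theorem exists_isPrimeElement (K : Type*) [Field K] [ValuativeRel K] [TopologicalSpace K]
    [IsNonarchimedeanLocalField K] : ∃ π : K, IsPrimeElement π := by
  obtain ⟨x, hx⟩ := ValuativeRel.valuation_surjective
    ((IsNonarchimedeanLocalField.valueGroupWithZeroIsoInt K).symm (WithZero.exp (-1)))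
  exact ⟨x, by simp [IsPrimeElement, w, hx]⟩

theorem mem_fracIdeal {n : ℤ} {x : K} : x ∈ fracIdeal K n ↔ x = 0 ∨ n ≤ w x := Iff.rfl

theorem mem_fracIdeal_of_ne_zero {n : ℤ} {x : K} (hx : x ≠ 0) :
    x ∈ fracIdeal K n ↔ n ≤ w x := by simp [mem_fracIdeal, hx]

theorem zero_mem_fracIdeal (n : ℤ) : (0 : K) ∈ fracIdeal K n := Or.inl rfl

theorem fracIdeal_eq_setOf_le {y : K} (hy : y ≠ 0) :
    fracIdeal K (w y) = {x | ValuativeRel.valuation K x ≤ ValuativeRel.valuation K y} := by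
  ext x
  by_cases hx : x = 0
  · simp [hx, zero_mem_fracIdeal]
  · rw [mem_fracIdeal_of_ne_zero hx, w_le_w_iff hy hx]; rfl

theorem IsPrimeElement.fracIdeal_eq {π : K} (hπ : IsPrimeElement π) (n : ℤ) :
    fracIdeal K n = {x | ValuativeRel.valuation K x ≤ ValuativeRel.valuation K (π ^ n)} := by
  rw [← fracIdeal_eq_setOf_le (zpow_ne_zero _ hπ.ne_zero), w_zpow, hπ, mul_one]

theorem fracIdeal_anti {m n : ℤ} (h : m ≤ n) : fracIdeal K n ⊆ fracIdeal K m := by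
  rintro x (hx | hx)
  · exact Or.inl hx
  · exact Or.inr (h.trans hx)

theorem add_mem_fracIdeal {n : ℤ} {x y : K} (hx : x ∈ fracIdeal K n) (hy : y ∈ fracIdeal K n) :
    x + y ∈ fracIdeal K n := by
  obtain ⟨π, hπ⟩ := exists_isPrimeElement K
  rw [hπ.fracIdeal_eq, Set.mem_ofPred_eq] at *
  exact (ValuativeRel.valuation K).map_add_le hx hy

theorem neg_mem_fracIdeal {n : ℤ} {x : K} (hx : x ∈ fracIdeal K n) : -x ∈ fracIdeal K n := by
  simpa [mem_fracIdeal] using hx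

theorem add_mem_fracIdeal_iff {n : ℤ} {x y : K} (hy : y ∈ fracIdeal K n) :
    x + y ∈ fracIdeal K n ↔ x ∈ fracIdeal K n :=
  ⟨fun h => by simpa using add_mem_fracIdeal h (neg_mem_fracIdeal hy),
    fun h => add_mem_fracIdeal h hy⟩

theorem mul_mem_fracIdeal {m n : ℤ} {x y : K} (hx : x ∈ fracIdeal K m) (hy : y ∈ fracIdeal K n) :
    x * y ∈ fracIdeal K (m + n) := by
  by_cases h : x * y = 0
  · exact Or.inl h
  · obtain ⟨h1, h2⟩ := mul_ne_zero_iff.1 h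
    rw [mem_fracIdeal_of_ne_zero h, w_mul h1 h2]
    exact add_le_add ((mem_fracIdeal_of_ne_zero h1).1 hx) ((mem_fracIdeal_of_ne_zero h2).1 hy)

theorem mul_mem_fracIdeal_iff {n : ℤ} {a x : K} (ha : a ≠ 0) :
    a * x ∈ fracIdeal K n ↔ x ∈ fracIdeal K (n - w a) := by
  by_cases hx : x = 0
  · simp [hx, zero_mem_fracIdeal]
  · rw [mem_fracIdeal_of_ne_zero hx, mem_fracIdeal_of_ne_zero (mul_ne_zero ha hx), w_mul ha hx]
    omega

theorem fracIdeal_mem_nhds_zero (n : ℤ) : fracIdeal K n ∈ 𝓝 (0 : K) := by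
  obtain ⟨π, hπ⟩ := exists_isPrimeElement K
  refine (IsValuativeTopology.hasBasis_nhds_zero' K).mem_iff.2
    ⟨ValuativeRel.valuation K (π ^ n), by simp [zpow_ne_zero, hπ.ne_zero], fun x hx => ?_⟩
  rw [hπ.fracIdeal_eq, Set.mem_ofPred_eq]
  rw [Set.mem_ofPred_eq] at hx
  exact hx.le

theorem exists_fracIdeal_subset {s : Set K} (hs : s ∈ 𝓝 (0 : K)) : ∃ n : ℤ, fracIdeal K n ⊆ s := by
  obtain ⟨γ, hγ, h⟩ := (IsValuativeTopology.hasBasis_nhds_zero' K).mem_iff.1 hs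
  obtain ⟨y, rfl⟩ := ValuativeRel.valuation_surjective γ
  have hy : y ≠ 0 := by simpa using hγ
  refine ⟨w y + 1, fun x hx => h ?_⟩
  by_cases hx0 : x = 0
  · simpa [hx0, zero_lt_iff] using hy
  · rw [mem_fracIdeal_of_ne_zero hx0] at hx
    by_contra hlt
    have := (w_le_w_iff hx0 hy).2 (not_lt.1 hlt)
    omega

theorem isCompact_fracIdeal (n : ℤ) : IsCompact (fracIdeal K n) := by
  obtain ⟨π, hπ⟩ := exists_isPrimeElement K
  rw [hπ.fracIdeal_eq]
  exact IsNonarchimedeanLocalField.isCompact_closedBall K _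

theorem isOpen_fracIdeal (n : ℤ) : IsOpen (fracIdeal K n) := by
  rw [isOpen_iff_mem_nhds]
  intro x hx
  have h := (continuous_sub_right x).tendsto x
  rw [sub_self] at h
  filter_upwards [h (fracIdeal_mem_nhds_zero n)] with y hy
  simpa using add_mem_fracIdeal hy hx

theorem w_add_eq {x y : K} (hx : x ≠ 0) (hy : y ∈ fracIdeal K (w x + 1)) : w (x + y) = w x := by
  have hmem : x + y ∉ fracIdeal K (w x + 1) := by
    rw [add_mem_fracIdeal_iff hy, mem_fracIdeal_of_ne_zero hx]; omega
  have h2 : x + y ∈ fracIdeal K (w x) :=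
    add_mem_fracIdeal (Or.inr le_rfl) (fracIdeal_anti (by omega) hy)
  simp only [mem_fracIdeal, not_or] at hmem h2
  have := h2.resolve_left hmem.1
  omega

theorem eventually_w_eq {x : K} (hx : x ≠ 0) : ∀ᶠ y in 𝓝 x, y ≠ 0 ∧ w y = w x := by
  have h := (continuous_sub_right x).tendsto x
  rw [sub_self] at h
  filter_upwards [h (fracIdeal_mem_nhds_zero (w x + 1))] with y hy
  have h1 := w_add_eq hx hy
  rw [add_sub_cancel] at h1
  refine ⟨?_, h1⟩
  rintro rfl
  have : -x ∈ fracIdeal K (w x + 1) := by simpa using hy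
  have := neg_mem_fracIdeal this
  rw [neg_neg, mem_fracIdeal_of_ne_zero hx] at this
  omega

instance instT2Space : T2Space K := by
  have : T1Space K := by
    refine ⟨fun x => ?_⟩
    rw [← isOpen_compl_iff, isOpen_iff_mem_nhds]
    intro y hy
    have hyx : y - x ≠ 0 := sub_ne_zero.2 hy
    filter_upwards [((continuous_sub_right x).tendsto y).eventually (eventually_w_eq hyx)] with z hz
    exact fun h => hz.1 (sub_eq_zero.2 h)
  infer_instance

theorem isClosed_fracIdeal (n : ℤ) : IsClosed (fracIdeal K n) := (isCompact_fracIdeal n).isClosed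

/-- The shell of elements of valuation `n`. -/
def shell (K : Type*) [Field K] [ValuativeRel K] [TopologicalSpace K]
    [IsNonarchimedeanLocalField K] (n : ℤ) : Set K := fracIdeal K n \ fracIdeal K (n + 1)

theorem mem_shell {n : ℤ} {x : K} : x ∈ shell K n ↔ x ≠ 0 ∧ w x = n := by
  simp only [shell, Set.mem_sdiff, mem_fracIdeal]
  by_cases hx : x = 0
  · simp [hx]
  · simp only [hx, false_or, ne_eq, not_false_eq_true, true_and]; omega

theorem isClopen_shell (n : ℤ) : IsClopen (shell K n) :=
  IsClopen.diff ⟨isClosed_fracIdeal _, isOpen_fracIdeal _⟩ ⟨isClosed_fracIdeal _, isOpen_fracIdeal _⟩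

theorem isCompact_shell (n : ℤ) : IsCompact (shell K n) :=
  (isCompact_fracIdeal n).of_isClosed_subset (isClopen_shell n).1 Set.sdiff_subset

theorem exists_subset_fracIdeal {s : Set K} (hs : IsCompact s) : ∃ n : ℤ, s ⊆ fracIdeal K n := by
  obtain ⟨n, hn⟩ := hs.elim_directed_cover (fun n : ℤ => fracIdeal K n) isOpen_fracIdeal
    (fun x _ => Set.mem_iUnion.2 ⟨w x, Or.inr le_rfl⟩)
    (fun a b => ⟨min a b, fracIdeal_anti (min_le_left _ _), fracIdeal_anti (min_le_right _ _)⟩)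
  exact ⟨n, hn⟩

theorem hasCompactSupport_iff_fracIdeal {E : Type*} [Zero E] {f : K → E} :
    HasCompactSupport f ↔ ∃ n : ℤ, ∀ x, x ∉ fracIdeal K n → f x = 0 := by
  constructor
  · intro h
    obtain ⟨n, hn⟩ := exists_subset_fracIdeal h
    exact ⟨n, fun x hx => image_eq_zero_of_notMem_tsupport fun h => hx (hn h)⟩
  · rintro ⟨n, hn⟩
    exact HasCompactSupport.intro (isCompact_fracIdeal n) hn

theorem nabla_zero (π : K) : nabla π 0 = 0 := by simp [nabla]

theorem nabla_mul {π : K} (hπ : IsPrimeElement π) (x y : K) :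
    nabla π (x * y) = nabla π x * nabla π y := by
  by_cases hx : x = 0
  · simp [hx, nabla]
  by_cases hy : y = 0
  · simp [hy, nabla]
  rw [nabla, nabla, nabla, w_mul hx hy, zpow_add₀ hπ.ne_zero]
  ring

theorem nabla_ne_zero {π : K} (hπ : IsPrimeElement π) {x : K} (hx : x ≠ 0) : nabla π x ≠ 0 :=
  mul_ne_zero (zpow_ne_zero _ hπ.ne_zero) hx

theorem w_nabla {π : K} (hπ : IsPrimeElement π) (x : K) : w (nabla π x) = 2 * w x := by
  by_cases hx : x = 0
  · simp [hx, nabla]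
  rw [nabla, hπ.w_zpow_mul _ hx]; ring

theorem nabla_mem_fracIdeal_iff {π : K} (hπ : IsPrimeElement π) {n : ℤ} {x : K} :
    nabla π x ∈ fracIdeal K n ↔ x = 0 ∨ n ≤ 2 * w x := by
  by_cases hx : x = 0
  · simp [hx, nabla_zero, zero_mem_fracIdeal]
  · rw [mem_fracIdeal_of_ne_zero (nabla_ne_zero hπ hx), w_nabla hπ]; simp [hx]

theorem continuous_nabla {π : K} (hπ : IsPrimeElement π) : Continuous (nabla π) := by
  rw [continuous_iff_continuousAt]
  intro x
  by_cases hx : x = 0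
  · subst hx
    rw [ContinuousAt, nabla_zero]
    intro s hs
    obtain ⟨n, hn⟩ := exists_fracIdeal_subset hs
    -- As `∇` doubles the valuation, `w y ≥ n` gives `2 * w y ≥ n` only for nonnegative `w y`,
    -- whence the `max` with `0`.
    refine mem_map.2 (mem_of_superset (fracIdeal_mem_nhds_zero (max n 0)) fun y hy => hn ?_)
    rw [nabla_mem_fracIdeal_iff hπ]
    rcases hy with hy | hy
    · exact Or.inl hy
    · right; omega
  · have : nabla π =ᶠ[𝓝 x] fun y => π ^ w x * y := by
      filter_upwards [eventually_w_eq hx] with y hy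
      rw [nabla, hy.2]
    exact (continuousAt_const.mul continuousAt_id).congr_of_eventuallyEq this

end Valuation

/-! ### Haar measure of balls and the modulus of a dilation -/

section Measure

open Filter Topology

variable {K : Type*} [Field K] [ValuativeRel K] [TopologicalSpace K]
  [IsNonarchimedeanLocalField K]

theorem mem_fracIdeal_zero_iff {x : K} : x ∈ fracIdeal K 0 ↔ x ∈ 𝒪[K] := by
  obtain ⟨π, hπ⟩ := exists_isPrimeElement K
  rw [hπ.fracIdeal_eq, Set.mem_ofPred_eq, zpow_zero, map_one, Valuation.mem_integer_iff]

theorem residue_eq_zero_iff_mem_fracIdeal_one (x : 𝒪[K]) :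
    IsLocalRing.residue 𝒪[K] x = 0 ↔ (x : K) ∈ fracIdeal K 1 := by
  rw [IsLocalRing.residue_eq_zero_iff, IsLocalRing.mem_maximalIdeal, mem_nonunits_iff,
    (Valuation.integer.integers (ValuativeRel.valuation K)).isUnit_iff_valuation_eq_one]
  change ¬ ValuativeRel.valuation K (x : K) = 1 ↔ _
  have hx1 : ValuativeRel.valuation K (x : K) ≤ 1 := x.2
  by_cases hx : (x : K) = 0
  · simp [hx, zero_mem_fracIdeal]
  rw [mem_fracIdeal_of_ne_zero hx]
  have h1 := w_le_w_iff hx (one_ne_zero (α := K))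
  have h2 := w_le_w_iff (one_ne_zero (α := K)) hx
  rw [w_one, map_one] at h1 h2
  rw [show ValuativeRel.valuation K (x : K) = 1 ↔ w (x : K) ≤ 0 from
    ⟨fun h => h1.2 h.ge, fun h => le_antisymm hx1 (h1.1 h)⟩]
  omega

theorem hasCompactSupport_indicator {s : Set K} (hs : IsCompact s) (f : K → ℂ) :
    HasCompactSupport (s.indicator f) :=
  HasCompactSupport.intro hs fun _ hx => Set.indicator_of_notMem hx f

theorem isClopen_fracIdeal (n : ℤ) : IsClopen (fracIdeal K n) :=
  ⟨isClosed_fracIdeal n, isOpen_fracIdeal n⟩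

theorem card_residueField_pos : (0 : ℝ) < Nat.card 𝓀[K] := by
  exact_mod_cast Nat.card_pos

theorem one_lt_card_residueField : (1 : ℝ) < Nat.card 𝓀[K] := by
  exact_mod_cast Finite.one_lt_card (α := 𝓀[K])

theorem measureReal_fracIdeal_pos [MeasurableSpace K] (μ : Measure K) [μ.IsAddHaarMeasure]
    (n : ℤ) : 0 < μ.real (fracIdeal K n) :=
  ENNReal.toReal_pos ((isOpen_fracIdeal n).measure_pos μ ⟨0, zero_mem_fracIdeal n⟩).ne'
    (isCompact_fracIdeal n).measure_ne_top

variable [MeasurableSpace K] [BorelSpace K] (μ : Measure K)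

theorem measurableSet_fracIdeal (n : ℤ) : MeasurableSet (fracIdeal K n) :=
  (isOpen_fracIdeal n).measurableSet

theorem measurableSet_shell (n : ℤ) : MeasurableSet (shell K n) :=
  (isClopen_shell n).2.measurableSet

theorem integral_indicator_fracIdeal_comp_mul {a : K} (ha : a ≠ 0) (n : ℤ) :
    ∫ x, (fracIdeal K n).indicator (fun _ => (1 : ℂ)) (a * x) ∂μ
      = μ.real (fracIdeal K (n - w a)) := by
  rw [show (fun x => (fracIdeal K n).indicator (fun _ => (1 : ℂ)) (a * x)) =
    (fracIdeal K (n - w a)).indicator (fun _ => (1 : ℂ)) from ?_,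
    integral_indicator (measurableSet_fracIdeal _)]
  · simp
  · ext x
    by_cases hx : x ∈ fracIdeal K (n - w a)
    · rw [Set.indicator_of_mem hx, Set.indicator_of_mem ((mul_mem_fracIdeal_iff ha).2 hx)]
    · rw [Set.indicator_of_notMem hx,
        Set.indicator_of_notMem (mt (mul_mem_fracIdeal_iff ha).1 hx)]

variable [μ.IsAddHaarMeasure]

/-- The ring of integers is the disjoint union of the cosets of its maximal ideal, indexed by the
residue field. -/
theorem measureReal_fracIdeal_zero_eq_card_mul :
    μ.real (fracIdeal K 0) = Nat.card 𝓀[K] * μ.real (fracIdeal K 1) := by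
  choose s hs using IsLocalRing.residue_surjective (R := 𝒪[K])
  have hU : fracIdeal K 0 = ⋃ k : 𝓀[K], (fun x => -(s k : K) + x) ⁻¹' fracIdeal K 1 := by
    ext x
    simp only [Set.mem_iUnion, Set.mem_preimage]
    constructor
    · intro hx
      let y : 𝒪[K] := ⟨x, mem_fracIdeal_zero_iff.1 hx⟩
      refine ⟨IsLocalRing.residue _ y, ?_⟩
      have := (residue_eq_zero_iff_mem_fracIdeal_one (-s (IsLocalRing.residue _ y) + y)).1
        (by rw [map_add, map_neg, hs]; simp)
      simpa using this
    · rintro ⟨k, hk⟩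
      have h1 : (s k : K) ∈ fracIdeal K 0 := mem_fracIdeal_zero_iff.2 (s k).2
      simpa using add_mem_fracIdeal h1 (fracIdeal_anti zero_le_one hk)
  have hdisj : Pairwise (Function.onFun Disjoint
      fun k : 𝓀[K] => (fun x => -(s k : K) + x) ⁻¹' fracIdeal K 1) := by
    intro k l hkl
    refine Set.disjoint_left.2 fun x hk hl => hkl ?_
    have h := add_mem_fracIdeal hl (neg_mem_fracIdeal hk)
    have h2 := (residue_eq_zero_iff_mem_fracIdeal_one (s k - s l)).2 (by
      convert h using 1
      push_cast
      ring)
    rw [map_sub, hs, hs] at h2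
    exact sub_eq_zero.1 h2
  have key : μ (fracIdeal K 0) = Nat.card 𝓀[K] * μ (fracIdeal K 1) := by
    rw [hU, measure_iUnion hdisj
      fun k => (measurable_const_add _) (measurableSet_fracIdeal 1)]
    simp only [measure_preimage_add]
    have := Fintype.ofFinite 𝓀[K]
    rw [tsum_fintype, Finset.sum_const, Nat.card_eq_fintype_card, nsmul_eq_mul, Finset.card_univ]
  rw [Measure.real, key, ENNReal.toReal_mul, ENNReal.toReal_natCast]; rfl

/-- Multiplication by a non-zero element as an automorphism of the additive group. -/
def mulAddEquiv (a : K) (ha : a ≠ 0) : K ≃+ K :=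
  { Homeomorph.mulLeft₀ a ha with map_add' := mul_add a }

theorem isAddHaarMeasure_map_mul {a : K} (ha : a ≠ 0) :
    (μ.map (a * ·)).IsAddHaarMeasure :=
  AddEquiv.isAddHaarMeasure_map μ (mulAddEquiv a ha) (Homeomorph.mulLeft₀ a ha).continuous
    (Homeomorph.mulLeft₀ a ha).symm.continuous

/-- The push-forward of a Haar measure under a dilation is again a Haar measure, so uniqueness
supplies the scalar. Uniqueness is applied to real and imaginary parts separately. -/
theorem exists_integral_comp_mul_eq {a : K} (ha : a ≠ 0) : ∃ c : ℝ, ∀ f : K → ℂ, Continuous f →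
    HasCompactSupport f → ∫ x, f (a * x) ∂μ = c * ∫ x, f x ∂μ := by
  have := isAddHaarMeasure_map_mul μ ha
  refine ⟨(μ.map (a * ·)).addHaarScalarFactor μ, fun f hf hc => ?_⟩
  rw [show ∫ x, f (a * x) ∂μ = ∫ x, f x ∂(μ.map (a * ·)) from
    ((Homeomorph.mulLeft₀ a ha).measurableEmbedding.integral_map (μ := μ) f).symm]
  have hre := Measure.integral_isAddLeftInvariant_eq_smul_of_hasCompactSupport (μ.map (a * ·)) μ
    (RCLike.continuous_re.comp hf) (hc.comp_left (g := RCLike.re) (by simp))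
  have him := Measure.integral_isAddLeftInvariant_eq_smul_of_hasCompactSupport (μ.map (a * ·)) μ
    (RCLike.continuous_im.comp hf) (hc.comp_left (g := RCLike.im) (by simp))
  rw [integral_smul_nnreal_measure, NNReal.smul_def] at hre him
  simp only [Function.comp_apply] at hre him
  rw [← integral_re_add_im (hf.integrable_of_hasCompactSupport hc),
    ← integral_re_add_im (hf.integrable_of_hasCompactSupport hc), hre, him]
  simp only [smul_eq_mul, RCLike.ofReal_mul, RCLike.ofReal_eq_complex_ofReal]
  ring

/-- Testing on indicators of balls ties the unknown modulus `c` to ratios of ball volumes, from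
which it is computed later. -/
theorem exists_measureReal_fracIdeal_eq {a : K} (ha : a ≠ 0) : ∃ c : ℝ,
    (∀ n : ℤ, μ.real (fracIdeal K (n - w a)) = c * μ.real (fracIdeal K n)) ∧
    ∀ f : K → ℂ, Continuous f →
    HasCompactSupport f → ∫ x, f (a * x) ∂μ = c * ∫ x, f x ∂μ := by
  obtain ⟨c, hc⟩ := exists_integral_comp_mul_eq μ ha
  refine ⟨c, fun n => ?_, hc⟩
  have h1 := hc _ ((isClopen_fracIdeal n).continuous_indicator continuous_const)
    (hasCompactSupport_indicator (isCompact_fracIdeal n) (fun _ => (1 : ℂ)))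
  rw [integral_indicator_fracIdeal_comp_mul μ ha] at h1
  have h2 := integral_indicator_fracIdeal_comp_mul μ one_ne_zero n
  simp only [one_mul, w_one, sub_zero] at h2
  rw [h2] at h1
  exact_mod_cast h1

theorem measureReal_fracIdeal_succ (n : ℤ) :
    μ.real (fracIdeal K n) = Nat.card 𝓀[K] * μ.real (fracIdeal K (n + 1)) := by
  obtain ⟨π, hπ⟩ := exists_isPrimeElement K
  obtain ⟨c, hc, -⟩ := exists_measureReal_fracIdeal_eq μ (zpow_ne_zero (-n) hπ.ne_zero)
  have hw : w (π ^ (-n)) = -n := by rw [w_zpow, hπ, mul_one]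
  have h0 := hc 0
  have h1 := hc 1
  rw [hw, sub_neg_eq_add] at h0 h1
  rw [zero_add] at h0
  rw [add_comm n 1, h1, h0, measureReal_fracIdeal_zero_eq_card_mul]
  ring

theorem measureReal_fracIdeal_add (m n : ℤ) :
    μ.real (fracIdeal K (m + n)) = (Nat.card 𝓀[K] : ℝ) ^ (-n) * μ.real (fracIdeal K m) := by
  have hq := (card_residueField_pos (K := K)).ne'
  induction n using Int.induction_on with
  | zero => simp
  | succ i ih =>
    rw [measureReal_fracIdeal_succ, add_assoc] at ih
    rw [neg_add, zpow_add₀ hq, zpow_neg_one, mul_right_comm, ← ih]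
    field_simp
  | pred i ih =>
    rw [measureReal_fracIdeal_succ, add_assoc, sub_add_cancel, ih, neg_sub, sub_neg_eq_add,
      zpow_add₀ hq, zpow_one, neg_neg]
    ring

theorem integral_comp_mul {a : K} (ha : a ≠ 0) {f : K → ℂ} (hf : Continuous f)
    (hc : HasCompactSupport f) :
    ∫ x, f (a * x) ∂μ = (Nat.card 𝓀[K] : ℂ) ^ (w a) * ∫ x, f x ∂μ := by
  obtain ⟨c, h1, h2⟩ := exists_measureReal_fracIdeal_eq μ ha
  have h := h1 0
  rw [sub_eq_add_neg, measureReal_fracIdeal_add, neg_neg] at h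
  have hc' := mul_right_cancel₀ (measureReal_fracIdeal_pos μ 0).ne' h
  rw [h2 f hf hc, ← hc']
  push_cast
  rfl

theorem measure_singleton_zero : μ {(0 : K)} = 0 := by
  have hle : ∀ n : ℕ, μ.real {(0 : K)} ≤
      ((Nat.card 𝓀[K] : ℝ)⁻¹) ^ n * μ.real (fracIdeal K 0) := fun n => by
    have h := measureReal_fracIdeal_add μ 0 n
    rw [zpow_neg, zpow_natCast, ← inv_pow] at h
    rw [← h]
    exact measureReal_mono (Set.singleton_subset_iff.2 (zero_mem_fracIdeal _))
      (isCompact_fracIdeal _).measure_ne_top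
  have hlim := (tendsto_pow_atTop_nhds_zero_of_lt_one
    (inv_nonneg.2 (card_residueField_pos (K := K)).le)
    (inv_lt_one_of_one_lt₀ (one_lt_card_residueField (K := K)))).mul_const (μ.real (fracIdeal K 0))
  rw [zero_mul] at hlim
  have h0 := ge_of_tendsto' hlim hle
  have h1 : μ.real {(0 : K)} = 0 := le_antisymm h0 measureReal_nonneg
  exact (measureReal_eq_zero_iff (isCompact_singleton.measure_ne_top)).1 h1

end Measure

/-! ### Stability of the Schwartz–Bruhat space; existence of the conductor -/

section SchwartzBruhat

open Filter Topology

variable {K : Type*} [Field K] [ValuativeRel K] [TopologicalSpace K]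
  [IsNonarchimedeanLocalField K]

theorem W_apply_zero (π : K) (f : K → ℂ) : W π f 0 = f 0 := by simp [W]

theorem W_apply_even (π : K) (f : K → ℂ) {x : K} (hx : x ≠ 0) {m : ℤ} (h : w x = 2 * m) :
    W π f x = f (π ^ (-m) * x) := by
  rw [W, if_neg hx, if_pos (h ▸ even_two_mul m), h, show -(2 * m) / 2 = -m by omega]

theorem W_apply_odd (π : K) (f : K → ℂ) {x : K} (hx : x ≠ 0) {m : ℤ} (h : w x = 2 * m + 1) :
    W π f x = f (π ^ (-(m + 1)) * x) := by
  rw [W, if_neg hx, if_neg (by rw [h, Int.not_even_iff_odd]; exact odd_two_mul_add_one m), h,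
    show (-(2 * m + 1) - 1) / 2 = -(m + 1) by omega]

/-- Treats both parities at once: behaviour near `0` and at infinity needs only the floor of `w x /
2`. -/
theorem exists_W_apply_eq {π : K} (hπ : IsPrimeElement π) (f : K → ℂ) {x : K} (hx : x ≠ 0) :
    ∃ y : K, y ≠ 0 ∧ w y = w x / 2 ∧ W π f x = f y := by
  obtain ⟨m, h | h⟩ := Int.even_or_odd' (w x)
  · exact ⟨π ^ (-m) * x, mul_ne_zero (zpow_ne_zero _ hπ.ne_zero) hx,
      by rw [hπ.w_zpow_mul _ hx]; omega, W_apply_even π f hx h⟩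
  · exact ⟨π ^ (-(m + 1)) * x, mul_ne_zero (zpow_ne_zero _ hπ.ne_zero) hx,
      by rw [hπ.w_zpow_mul _ hx]; omega, W_apply_odd π f hx h⟩

theorem W_mem_schwartzBruhat {π : K} (hπ : IsPrimeElement π) {f : K → ℂ}
    (hf : f ∈ SchwartzBruhat K) : W π f ∈ SchwartzBruhat K := by
  obtain ⟨hl, hc⟩ := hf
  refine ⟨(IsLocallyConstant.iff_eventually_eq _).2 fun x => ?_, ?_⟩
  · rw [IsLocallyConstant.iff_eventually_eq] at hl
    by_cases hx : x = 0
    · subst hx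
      obtain ⟨n, hn⟩ := exists_fracIdeal_subset (hl 0)
      -- `2 * n ≤ w y` is equivalent to `n ≤ w y / 2`.
      filter_upwards [fracIdeal_mem_nhds_zero (2 * n)] with y hy
      rw [W_apply_zero]
      by_cases hy0 : y = 0
      · rw [hy0, W_apply_zero]
      · obtain ⟨z, hz, hwz, h⟩ := exists_W_apply_eq hπ f hy0
        rw [mem_fracIdeal_of_ne_zero hy0] at hy
        rw [h]
        exact hn (Or.inr (by omega))
    -- On a single shell the power of `π` is fixed, so `W f` is `f` after one dilation.
    · have key : ∃ c : K, ∀ y : K, y ≠ 0 → w y = w x → W π f y = f (c * y) := by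
        obtain ⟨m, h | h⟩ := Int.even_or_odd' (w x)
        · exact ⟨_, fun y hy hw => W_apply_even π f hy (hw.trans h)⟩
        · exact ⟨_, fun y hy hw => W_apply_odd π f hy (hw.trans h)⟩
      obtain ⟨c, hcW⟩ := key
      filter_upwards [eventually_w_eq hx, (continuous_const_mul c).tendsto x (hl (c * x))]
        with y hy hy2
      rw [hcW y hy.1 hy.2, hcW x hx rfl]
      exact hy2
  · rw [hasCompactSupport_iff_fracIdeal] at hc ⊢
    obtain ⟨n, hn⟩ := hc
    refine ⟨2 * n, fun x hx => ?_⟩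
    simp only [mem_fracIdeal, not_or] at hx
    obtain ⟨z, hz, hwz, h⟩ := exists_W_apply_eq hπ f hx.1
    rw [h]
    refine hn z ?_
    rw [mem_fracIdeal_of_ne_zero hz]
    omega

/-- Local constancy is made uniform by compactness of a ball containing the support. -/
theorem exists_forall_add_eq {f : K → ℂ} (hf : f ∈ SchwartzBruhat K) :
    ∃ n : ℤ, ∀ a ∈ fracIdeal K n, ∀ x, f (x + a) = f x := by
  obtain ⟨hl, hc⟩ := hf
  obtain ⟨N, hN⟩ := hasCompactSupport_iff_fracIdeal.1 hc
  rw [IsLocallyConstant.iff_eventually_eq] at hl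
  have h := (isCompact_fracIdeal N).eventually_forall_of_forall_eventually
    (x₀ := (0 : K)) (P := fun a x => f (x + a) = f x) fun x _ => by
      have h1 : Tendsto (fun z : K × K => z.2 + z.1) (𝓝 (0, x)) (𝓝 x) := by
        have : Continuous fun z : K × K => z.2 + z.1 := by fun_prop
        simpa using this.tendsto (0, x)
      have h2 : Tendsto (fun z : K × K => z.2) (𝓝 (0, x)) (𝓝 x) := continuous_snd.tendsto (0, x)
      filter_upwards [h1 (hl x), h2 (hl x)] with z hz1 hz2
      exact Eq.trans hz1 (Eq.symm hz2)
  obtain ⟨n, hn⟩ := exists_fracIdeal_subset h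
  -- Requiring also `a ∈ fracIdeal K N` makes translation by `a` preserve the complement of that
  -- ball, where `f` vanishes.
  refine ⟨max n N, fun a ha x => ?_⟩
  have haN := fracIdeal_anti (le_max_right n N) ha
  by_cases hx : x ∈ fracIdeal K N
  · exact hn (fracIdeal_anti (le_max_left n N) ha) x hx
  · rw [hN x hx, hN _ (mt (add_mem_fracIdeal_iff haN).1 hx)]

theorem comp_nabla_mem_schwartzBruhat {π : K} (hπ : IsPrimeElement π) {f : K → ℂ}
    (hf : f ∈ SchwartzBruhat K) : (fun x => f (nabla π x)) ∈ SchwartzBruhat K := by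
  refine ⟨hf.1.comp_continuous (continuous_nabla hπ), ?_⟩
  obtain ⟨n, hn⟩ := hasCompactSupport_iff_fracIdeal.1 hf.2
  refine hasCompactSupport_iff_fracIdeal.2 ⟨n / 2, fun x hx => hn _ ?_⟩
  simp only [mem_fracIdeal, not_or] at hx
  rw [nabla_mem_fracIdeal_iff hπ]
  simp only [hx.1, false_or]
  omega

theorem comp_mul_mem_schwartzBruhat {a : K} (ha : a ≠ 0) {f : K → ℂ}
    (hf : f ∈ SchwartzBruhat K) : (fun x => f (a * x)) ∈ SchwartzBruhat K :=
  ⟨hf.1.comp_continuous (continuous_const_mul a), hf.2.comp_homeomorph (Homeomorph.mulLeft₀ a ha)⟩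

theorem HasConductor.continuous {ψ : AddChar K Circle} {d : ℤ} (h : HasConductor ψ d) :
    Continuous ψ := by
  refine IsLocallyConstant.continuous ((IsLocallyConstant.iff_eventually_eq _).2 fun x => ?_)
  have ht := (continuous_sub_right x).tendsto x
  rw [sub_self] at ht
  filter_upwards [ht (fracIdeal_mem_nhds_zero d)] with y hy
  rw [← sub_add_cancel y x, AddChar.map_add_eq_mul, h.1 _ hy, one_mul]

/-- The circle has no small subgroups: while `‖u - 1‖ ≤ 1/2`, one has `‖u + 1‖ ≥ 3/2`, so each
squaring enlarges the distance to `1` by a factor of at least `3/2`. -/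
theorem exists_one_half_lt_norm_pow_sub_one (z : Circle) (hz : z ≠ 1) :
    ∃ n : ℕ, 1 / 2 < ‖((z ^ n : Circle) : ℂ) - 1‖ := by
  by_contra! h
  have hpos : 0 < ‖(z : ℂ) - 1‖ := norm_pos_iff.2 (sub_ne_zero.2 fun h => hz (Circle.ext h))
  have hgrow : ∀ k : ℕ, (3 / 2 : ℝ) ^ k * ‖(z : ℂ) - 1‖ ≤ ‖((z ^ 2 ^ k : Circle) : ℂ) - 1‖ := by
    intro k
    induction k with
    | zero => simp
    | succ k ih =>
      set u : ℂ := ((z ^ 2 ^ k : Circle) : ℂ) with hu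
      have h1 : ((z ^ 2 ^ (k + 1) : Circle) : ℂ) - 1 = (u - 1) * (u + 1) := by
        rw [pow_succ, pow_mul, Circle.coe_pow, ← hu]; ring
      have h2 : ‖u - 1‖ ≤ 1 / 2 := h (2 ^ k)
      have h3 : (3 / 2 : ℝ) ≤ ‖u + 1‖ := by
        have h4 : ‖(2 : ℂ)‖ ≤ ‖u + 1‖ + ‖u - 1‖ := by
          rw [show (2 : ℂ) = (u + 1) - (u - 1) by ring]
          exact norm_sub_le _ _
        rw [Complex.norm_two] at h4
        linarith
      rw [h1, norm_mul, pow_succ]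
      calc (3 / 2 : ℝ) ^ k * (3 / 2) * ‖(z : ℂ) - 1‖
          = (3 / 2 : ℝ) ^ k * ‖(z : ℂ) - 1‖ * (3 / 2) := by ring
        _ ≤ ‖u - 1‖ * ‖u + 1‖ := mul_le_mul ih h3 (by norm_num) (norm_nonneg _)
  obtain ⟨k, hk⟩ := pow_unbounded_of_one_lt ((1 / 2) / ‖(z : ℂ) - 1‖)
    (show (1 : ℝ) < 3 / 2 by norm_num)
  rw [div_lt_iff₀ hpos] at hk
  linarith [hgrow k, h (2 ^ k)]

theorem nsmul_mem_fracIdeal {n : ℤ} {x : K} (hx : x ∈ fracIdeal K n) (k : ℕ) :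
    k • x ∈ fracIdeal K n := by
  induction k with
  | zero => simpa using zero_mem_fracIdeal n
  | succ k ih => rw [succ_nsmul]; exact add_mem_fracIdeal ih hx

/-- A small ball is an additive subgroup whose image lies near `1`, hence is trivial. A point `y`
with `ψ y ≠ 1` bounds the admissible indices below by `w y`, so a least one exists. -/
theorem exists_hasConductor {ψ : AddChar K Circle} (hψ : Continuous ψ) (hψ1 : ψ ≠ 1) :
    ∃ d : ℤ, HasConductor ψ d := by
  have hcont : Continuous fun x : K => ‖((ψ x : Circle) : ℂ) - 1‖ := by fun_prop
  have h0 : ∀ᶠ x : K in 𝓝 0, ‖((ψ x : Circle) : ℂ) - 1‖ < 1 / 2 :=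
    hcont.continuousAt.eventually_lt_const (by simp)
  obtain ⟨n, hn⟩ := exists_fracIdeal_subset h0
  have hP : ∃ n : ℤ, ∀ x ∈ fracIdeal K n, ψ x = 1 := by
    refine ⟨n, fun x hx => ?_⟩
    by_contra hne
    obtain ⟨k, hk⟩ := exists_one_half_lt_norm_pow_sub_one _ hne
    rw [← AddChar.map_nsmul_eq_pow] at hk
    exact absurd (hn (nsmul_mem_fracIdeal hx k)) (not_lt.2 hk.le)
  obtain ⟨y, hy⟩ : ∃ y, ψ y ≠ 1 := by
    by_contra! h
    exact hψ1 (DFunLike.ext _ _ h)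
  obtain ⟨d, hd, hmin⟩ := Int.exists_least_of_bdd
    (P := fun n : ℤ => ∀ x ∈ fracIdeal K n, ψ x = 1)
    ⟨w y, fun m hm => by
      by_contra! hlt
      exact hy (hm y (Or.inr hlt.le))⟩ hP
  refine ⟨d, hd, ?_⟩
  by_contra! h
  have := hmin (d - 1) h
  omega

variable [MeasurableSpace K] [BorelSpace K] (μ : Measure K) [μ.IsAddHaarMeasure]

/-- The usual duality: bounded support of `f` gives local constancy of the transform, and invariance
of `f` under small translations gives bounded support. -/
theorem fourier_mem_schwartzBruhat {ψ : AddChar K Circle} {d : ℤ} (hd : HasConductor ψ d)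
    {f : K → ℂ} (hf : f ∈ SchwartzBruhat K) : fourier μ ψ f ∈ SchwartzBruhat K := by
  constructor
  · obtain ⟨N, hN⟩ := hasCompactSupport_iff_fracIdeal.1 hf.2
    refine (IsLocallyConstant.iff_eventually_eq _).2 fun y => ?_
    have ht := (continuous_sub_right y).tendsto y
    rw [sub_self] at ht
    filter_upwards [ht (fracIdeal_mem_nhds_zero (d - N))] with z hz
    refine integral_congr_ae (Eventually.of_forall fun x => ?_)
    by_cases hx : x ∈ fracIdeal K N
    · have h1 : ψ (x * (z - y)) = 1 :=
        hd.1 _ (by simpa using mul_mem_fracIdeal hx hz)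
      have h2 : ψ (x * z) = ψ (x * y) := by
        rw [show x * z = x * (z - y) + x * y by ring, AddChar.map_add_eq_mul, h1, one_mul]
      simp only [h2]
    · simp only [hN x hx, zero_mul]
  · obtain ⟨M, hM⟩ := exists_forall_add_eq hf
    obtain ⟨t, ht, ht1⟩ := hd.2
    have ht0 : t ≠ 0 := by
      rintro rfl
      exact ht1 (AddChar.map_zero_eq_one ψ)
    refine hasCompactSupport_iff_fracIdeal.2 ⟨d - M, fun y hy => ?_⟩
    simp only [mem_fracIdeal, not_or] at hy
    -- Translating by `t * y⁻¹` fixes `f` but multiplies the integral by `ψ t ≠ 1`, so the transform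
    -- vanishes at `y`.
    have ha : t * y⁻¹ ∈ fracIdeal K M := by
      right
      rw [w_mul ht0 (inv_ne_zero hy.1), w_inv]
      rw [mem_fracIdeal_of_ne_zero ht0] at ht
      omega
    have h1 : fourier μ ψ f y = (ψ t : ℂ) * fourier μ ψ f y := by
      conv_lhs => rw [fourier, ← integral_add_right_eq_self _ (t * y⁻¹)]
      rw [fourier, ← integral_const_mul]
      congr 1
      ext x
      rw [hM _ ha, add_mul, inv_mul_cancel_right₀ hy.1, AddChar.map_add_eq_mul, Circle.coe_mul]
      ring
    have h2 : (1 - (ψ t : ℂ)) * fourier μ ψ f y = 0 := by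
      rw [sub_mul, one_mul, ← h1, sub_self]
    exact (mul_eq_zero.1 h2).resolve_left fun h => ht1 (Circle.ext (sub_eq_zero.1 h).symm)

theorem starTransform_mem_schwartzBruhat {ψ : AddChar K Circle} {d : ℤ} (hd : HasConductor ψ d)
    {π : K} (hπ : IsPrimeElement π) {f : K → ℂ} (hf : f ∈ SchwartzBruhat K) :
    starTransform μ ψ π f ∈ SchwartzBruhat K :=
  comp_nabla_mem_schwartzBruhat hπ
    (fourier_mem_schwartzBruhat μ hd (W_mem_schwartzBruhat hπ hf))

end SchwartzBruhat

/-! ### The `*`-transform as an integral operator -/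

section Substitution

open Filter Topology

variable {K : Type*} [Field K] [ValuativeRel K] [TopologicalSpace K]
  [IsNonarchimedeanLocalField K]

open Classical in
/-- The normalised absolute value, with complex values. -/
noncomputable def absValue (x : K) : ℂ := if x = 0 then 0 else (Nat.card 𝓀[K] : ℂ) ^ (-w x)

theorem absValue_of_ne_zero {x : K} (hx : x ≠ 0) : absValue x = (Nat.card 𝓀[K] : ℂ) ^ (-w x) :=
  if_neg hx

theorem absValue_mul_of_w_eq_zero {u : K} (hu : u ≠ 0) (hu0 : w u = 0) (x : K) :
    absValue (u * x) = absValue x := by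
  by_cases hx : x = 0
  · simp [hx]
  · rw [absValue_of_ne_zero hx, absValue_of_ne_zero (mul_ne_zero hu hx), w_mul hu hx, hu0, zero_add]

theorem continuous_absValue : Continuous (absValue : K → ℂ) := by
  rw [continuous_iff_continuousAt]
  intro x
  by_cases hx : x = 0
  · subst hx
    rw [ContinuousAt, absValue, if_pos rfl, tendsto_zero_iff_norm_tendsto_zero,
      Metric.tendsto_nhds]
    intro ε hε
    have hq := one_lt_card_residueField (K := K)
    obtain ⟨n, hn⟩ := exists_pow_lt_of_lt_one hε (inv_lt_one_of_one_lt₀ hq)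
    filter_upwards [fracIdeal_mem_nhds_zero (n : ℤ)] with y hy
    by_cases hy0 : y = 0
    · simpa [absValue, hy0] using hε
    · rw [mem_fracIdeal_of_ne_zero hy0] at hy
      rw [absValue_of_ne_zero hy0]
      simp only [norm_zpow, Complex.norm_natCast, dist_zero_right, Real.norm_natCast]
      refine lt_of_le_of_lt ?_ hn
      rw [inv_pow, ← zpow_natCast, ← zpow_neg]
      exact zpow_le_zpow_right₀ hq.le (by omega)
  · refine continuousAt_const.congr (f := fun _ => absValue x) ?_
    filter_upwards [eventually_w_eq hx] with y hy
    rw [absValue_of_ne_zero hx, absValue_of_ne_zero hy.1, hy.2]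

/-- The kernel through which the `*`-transform is an integral operator. -/
noncomputable def starKernel (ψ : AddChar K Circle) (π t : K) : ℂ :=
  (ψ (nabla π t) : ℂ) + (Nat.card 𝓀[K] : ℂ)⁻¹ * (ψ (π * nabla π t) : ℂ)

theorem continuous_starKernel {ψ : AddChar K Circle} (hψ : Continuous ψ) {π : K}
    (hπ : IsPrimeElement π) : Continuous (starKernel ψ π) := by
  have := continuous_nabla hπ
  unfold starKernel
  fun_prop

variable [MeasurableSpace K] [BorelSpace K] (μ : Measure K) [μ.IsAddHaarMeasure]

theorem integral_eq_tsum_of_iUnion_eq_compl_zero {s : ℤ → Set K} (hs : ∀ m, MeasurableSet (s m))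
    (hd : Pairwise (Function.onFun Disjoint s)) (hU : ⋃ m, s m = {0}ᶜ) {g : K → ℂ}
    (hg : Integrable g μ) : ∫ x, g x ∂μ = ∑' m, ∫ x in s m, g x ∂μ := by
  rw [← integral_iUnion hs hd hg.integrableOn, hU]
  refine (setIntegral_eq_integral_of_ae_compl_eq_zero ?_).symm
  have h : ∀ᵐ x ∂μ, x ≠ 0 := by
    rw [ae_iff]
    simpa using measure_singleton_zero μ
  filter_upwards [h] with x hx hx'
  exact absurd hx hx'

theorem setIntegral_shell_comp_zpow_mul {π : K} (hπ : IsPrimeElement π) {f h : K → ℂ}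
    (hf : Continuous f) (hh : Continuous h) (m e : ℤ) :
    ∫ u in shell K (m + e), f (π ^ (-e) * u) * h u ∂μ =
      (Nat.card 𝓀[K] : ℂ) ^ (-e) * ∫ v in shell K m, f v * h (π ^ e * v) ∂μ := by
  have hπe : π ^ (-e) ≠ 0 := zpow_ne_zero _ hπ.ne_zero
  rw [← integral_indicator (measurableSet_shell _), ← integral_indicator (measurableSet_shell _)]
  have hw : w (π ^ (-e)) = -e := by rw [w_zpow, hπ, mul_one]
  have key := integral_comp_mul μ hπe
    (f := (shell K m).indicator fun v => f v * h (π ^ e * v))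
    ((isClopen_shell m).continuous_indicator (by fun_prop))
    (hasCompactSupport_indicator (isCompact_shell m) _)
  rw [hw] at key
  rw [← key]
  congr 1
  ext u
  have hmem : π ^ (-e) * u ∈ shell K m ↔ u ∈ shell K (m + e) := by
    by_cases hu : u = 0
    · simp [hu, mem_shell]
    · rw [mem_shell, mem_shell, hπ.w_zpow_mul _ hu]
      simp only [mul_ne_zero hπe hu, hu, ne_eq, not_false_eq_true, true_and]
      omega
  by_cases hu : u ∈ shell K (m + e)
  · rw [Set.indicator_of_mem hu, Set.indicator_of_mem (hmem.2 hu), ← mul_assoc (π ^ e),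
      ← zpow_add₀ hπ.ne_zero, add_neg_cancel, zpow_zero, one_mul]
  · rw [Set.indicator_of_notMem hu, Set.indicator_of_notMem (mt hmem.1 hu)]

/-- The shells `2m` and `2m + 1` on the left both come from the shell `m` on the right. For `w v =
m`, `u = π ^ m * v = ∇v` has Jacobian `q ^ (-m) = |v|`, while `u = π ^ (m + 1) * v = π∇v` has the
extra factor `q⁻¹`. -/
theorem integral_W_mul_eq {π : K} (hπ : IsPrimeElement π) {f : K → ℂ}
    (hf : f ∈ SchwartzBruhat K) {h : K → ℂ} (hh : Continuous h) :
    ∫ u, W π f u * h u ∂μ = ∫ v, f v * absValue v *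
      (h (nabla π v) + (Nat.card 𝓀[K] : ℂ)⁻¹ * h (π * nabla π v)) ∂μ := by
  have hq : (Nat.card 𝓀[K] : ℂ) ≠ 0 := by exact_mod_cast (card_residueField_pos (K := K)).ne'
  have hfc : Continuous f := hf.1.continuous
  have hWf := W_mem_schwartzBruhat hπ hf
  have hWc : Continuous (W π f) := hWf.1.continuous
  have hn := continuous_nabla hπ
  have ha := continuous_absValue (K := K)
  have hLi : Integrable (fun u => W π f u * h u) μ :=
    (hWc.mul hh).integrable_of_hasCompactSupport (hWf.2.mul_right)
  have hRi : Integrable (fun v => f v * absValue v *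
      (h (nabla π v) + (Nat.card 𝓀[K] : ℂ)⁻¹ * h (π * nabla π v))) μ :=
    Continuous.integrable_of_hasCompactSupport (by fun_prop) ((hf.2.mul_right).mul_right)
  have hi : ∀ e : ℤ, Integrable (fun v => f v * h (π ^ e * v)) μ := fun e =>
    Continuous.integrable_of_hasCompactSupport (by fun_prop) hf.2.mul_right
  rw [integral_eq_tsum_of_iUnion_eq_compl_zero μ
      (s := fun m => shell K (2 * m) ∪ shell K (2 * m + 1))
      (fun m => (measurableSet_shell _).union (measurableSet_shell _)) ?_ ?_ hLi,
    integral_eq_tsum_of_iUnion_eq_compl_zero μ (s := fun m => shell K m)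
      measurableSet_shell ?_ ?_ hRi]
  · refine tsum_congr fun m => ?_
    have hdisj : Disjoint (shell K (2 * m)) (shell K (2 * m + 1)) := by
      refine Set.disjoint_left.2 fun x hx hy => ?_
      rw [mem_shell] at hx hy
      omega
    rw [setIntegral_union hdisj (measurableSet_shell _) hLi.integrableOn hLi.integrableOn]
    have he := setIntegral_shell_comp_zpow_mul μ hπ hfc hh m m
    have ho := setIntegral_shell_comp_zpow_mul μ hπ hfc hh m (m + 1)
    rw [← two_mul] at he
    rw [show m + (m + 1) = 2 * m + 1 by ring] at ho
    rw [setIntegral_congr_fun (s := shell K (2 * m))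
        (g := fun u => f (π ^ (-m) * u) * h u) (measurableSet_shell (2 * m))
        (fun u hu => by
          rw [mem_shell] at hu
          simp only [W_apply_even π f hu.1 hu.2]),
      setIntegral_congr_fun (s := shell K (2 * m + 1))
        (g := fun u => f (π ^ (-(m + 1)) * u) * h u) (measurableSet_shell _)
        (fun u hu => by
          rw [mem_shell] at hu
          simp only [W_apply_odd π f hu.1 hu.2]),
      he, ho, ← integral_const_mul, ← integral_const_mul, ← integral_add]
    · refine setIntegral_congr_fun (measurableSet_shell _) fun v hv => ?_
      rw [mem_shell] at hv
      simp only [absValue_of_ne_zero hv.1, nabla, hv.2]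
      rw [neg_add, zpow_add₀ hq, zpow_neg_one, zpow_add₀ hπ.ne_zero, zpow_one,
        mul_comm (π ^ m) π, mul_assoc π]
      ring
    · exact ((hi m).const_mul _).integrableOn
    · exact ((hi (m + 1)).const_mul _).integrableOn
  · intro m n hmn
    refine Set.disjoint_left.2 fun x hx hy => hmn ?_
    rw [mem_shell] at hx hy
    omega
  · ext x
    simp [mem_shell]
  · intro m n hmn
    refine Set.disjoint_left.2 fun x hx hy => hmn ?_
    simp only [Set.mem_union, mem_shell] at hx hy
    omega
  · ext x
    simp only [Set.mem_iUnion, Set.mem_union, mem_shell, Set.mem_compl_iff, Set.mem_singleton_iff]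
    refine ⟨fun ⟨m, hm⟩ => by tauto, fun hx => ⟨w x / 2, ?_⟩⟩
    simp only [hx, ne_eq, not_false_eq_true, true_and]
    omega

theorem starTransform_eq_integral {ψ : AddChar K Circle} (hψ : Continuous ψ) {π : K}
    (hπ : IsPrimeElement π) {f : K → ℂ} (hf : f ∈ SchwartzBruhat K) (x : K) :
    starTransform μ ψ π f x = ∫ v, f v * absValue v * starKernel ψ π (v * x) ∂μ := by
  rw [starTransform, fourier, integral_W_mul_eq μ hπ hf (h := fun u => (ψ (u * nabla π x) : ℂ))
    (by fun_prop)]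
  simp only [starKernel, nabla_mul hπ, mul_assoc]

end Substitution

/-! ### Independence of the prime, and scaling in the character -/

section DoubleTransform

open Filter Topology

variable {K : Type*} [Field K] [ValuativeRel K] [TopologicalSpace K]
  [IsNonarchimedeanLocalField K]

theorem add_mem_fracIdeal_iff_of_w_lt {x y : K} (hx : x ≠ 0) (h : w x < w y)
    (n : ℤ) : x + y ∈ fracIdeal K n ↔ n ≤ w x ∧ n ≤ w y := by
  constructor
  · intro hn
    by_contra hlt
    have hy' : y ∈ fracIdeal K (w x + 1) := Or.inr (by omega)
    have h1 := (add_mem_fracIdeal_iff hy').1 (fracIdeal_anti (show w x + 1 ≤ n by omega) hn)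
    rw [mem_fracIdeal_of_ne_zero hx] at h1
    omega
  · rintro ⟨h1, h2⟩
    exact add_mem_fracIdeal (Or.inr h1) (Or.inr h2)

theorem add_mem_fracIdeal_iff_of_w_ne {x y : K} (hx : x ≠ 0) (hy : y ≠ 0) (h : w x ≠ w y)
    (n : ℤ) : x + y ∈ fracIdeal K n ↔ n ≤ w x ∧ n ≤ w y := by
  rcases lt_or_gt_of_ne h with h | h
  · exact add_mem_fracIdeal_iff_of_w_lt hx h n
  · rw [add_comm, add_mem_fracIdeal_iff_of_w_lt hy h n, and_comm]

theorem zpow_mul_nabla_mem_fracIdeal_iff {π : K} (hπ : IsPrimeElement π) (i n : ℤ) (a : K) :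
    π ^ i * nabla π a ∈ fracIdeal K n ↔ a = 0 ∨ n ≤ i + 2 * w a := by
  rw [mul_mem_fracIdeal_iff (zpow_ne_zero _ hπ.ne_zero), nabla_mem_fracIdeal_iff hπ, w_zpow, hπ]
  refine or_congr Iff.rfl ?_
  omega

/-- The valuation of a sum of two terms `π ^ i ∇ a`, `π ^ j ∇ b` does not depend on `π`. -/
theorem zpow_mul_nabla_add_mem_fracIdeal_iff {π₁ π₂ : K} (h₁ : IsPrimeElement π₁)
    (h₂ : IsPrimeElement π₂) {i j : ℤ} (hi : 0 ≤ i ∧ i ≤ 1) (hj : 0 ≤ j ∧ j ≤ 1) (a b : K) (n : ℤ) :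
    π₁ ^ i * nabla π₁ a + π₁ ^ j * nabla π₁ b ∈ fracIdeal K n ↔
      π₂ ^ i * nabla π₂ a + π₂ ^ j * nabla π₂ b ∈ fracIdeal K n := by
  -- It is enough to describe membership by a condition `Q` not involving `π`.
  suffices h : ∃ Q : Prop, ∀ π : K, IsPrimeElement π →
      (π ^ i * nabla π a + π ^ j * nabla π b ∈ fracIdeal K n ↔ Q) by
    obtain ⟨Q, hQ⟩ := h
    rw [hQ _ h₁, hQ _ h₂]
  by_cases ha : a = 0
  · exact ⟨_, fun π hπ => by
      rw [ha, nabla_zero, mul_zero, zero_add]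
      exact zpow_mul_nabla_mem_fracIdeal_iff hπ j n b⟩
  by_cases hb : b = 0
  · exact ⟨_, fun π hπ => by
      rw [hb, nabla_zero, mul_zero, add_zero]
      exact zpow_mul_nabla_mem_fracIdeal_iff hπ i n a⟩
  by_cases heq : i + 2 * w a = j + 2 * w b
  · have hij : i = j := by omega
    have hab : w a = w b := by omega
    exact ⟨_, fun π hπ => by
      rw [nabla, nabla, ← hij, ← hab, ← mul_assoc, ← mul_assoc, ← mul_add,
        ← zpow_add₀ hπ.ne_zero, mul_mem_fracIdeal_iff (zpow_ne_zero _ hπ.ne_zero), w_zpow, hπ]⟩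
  · refine ⟨n ≤ i + 2 * w a ∧ n ≤ j + 2 * w b, fun π hπ => ?_⟩
    have hw : ∀ (i : ℤ) {a : K}, a ≠ 0 → w (π ^ i * nabla π a) = i + 2 * w a := fun i a ha => by
      rw [hπ.w_zpow_mul _ (nabla_ne_zero hπ ha), w_nabla hπ]
    rw [add_mem_fracIdeal_iff_of_w_ne
      (mul_ne_zero (zpow_ne_zero _ hπ.ne_zero) (nabla_ne_zero hπ ha))
      (mul_ne_zero (zpow_ne_zero _ hπ.ne_zero) (nabla_ne_zero hπ hb))
      (by rwa [hw i ha, hw j hb]), hw i ha, hw j hb]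

theorem nabla_mul_of_mem_shell_zero {π : K} (hπ : IsPrimeElement π) (a : K) {u : K}
    (hu : u ∈ shell K 0) : nabla π (a * u) = nabla π a * u := by
  rw [nabla_mul hπ]
  congr 1
  rw [nabla, (mem_shell.1 hu).2, zpow_zero, one_mul]

theorem starKernel_mul_starKernel_of_mem_shell (ψ : AddChar K Circle) {π : K}
    (hπ : IsPrimeElement π) (a b : K) {u : K} (hu : u ∈ shell K 0) :
    starKernel ψ π (a * u) * starKernel ψ π (b * u) =
      ∑ p ∈ Finset.range 2 ×ˢ Finset.range 2, (Nat.card 𝓀[K] : ℂ)⁻¹ ^ (p.1 + p.2) *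
        (ψ ((π ^ (p.1 : ℤ) * nabla π a + π ^ (p.2 : ℤ) * nabla π b) * u) : ℂ) := by
  rw [Finset.sum_product]
  simp only [starKernel, nabla_mul_of_mem_shell_zero hπ _ hu, Finset.sum_range_succ,
    Finset.sum_range_zero, add_mul, AddChar.map_add_eq_mul, Circle.coe_mul, Nat.cast_zero,
    Nat.cast_one, zpow_zero, zpow_one, one_mul, mul_assoc]
  ring

theorem hasConductor_mulShift {ψ : AddChar K Circle} {d : ℤ} (hd : HasConductor ψ d) {c : K}
    (hc : c ≠ 0) : HasConductor (ψ.mulShift c) (d - w c) := by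
  refine ⟨fun x hx => ?_, ?_⟩
  · rw [AddChar.mulShift_apply]
    exact hd.1 _ ((mul_mem_fracIdeal_iff hc).2 hx)
  · obtain ⟨t, ht, ht1⟩ := hd.2
    refine ⟨c⁻¹ * t, ?_, ?_⟩
    · rw [mul_mem_fracIdeal_iff (inv_ne_zero hc), w_inv]
      convert ht using 2
      ring
    · rwa [AddChar.mulShift_apply, mul_inv_cancel_left₀ hc]

/-- Only even powers of `π` are absorbed in this way, because `∇` doubles valuations; hence the
parity condition on the conductors. -/
theorem starTransform_mulShift_sq [MeasurableSpace K] (μ : Measure K) (ψ : AddChar K Circle)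
    {π : K} (hπ : IsPrimeElement π) (e : ℤ) (f : K → ℂ) (x : K) :
    starTransform μ (ψ.mulShift (π ^ (2 * e))) π f x = starTransform μ ψ π f (π ^ e * x) := by
  have h : nabla π (π ^ e * x) = π ^ (2 * e) * nabla π x := by
    rw [nabla_mul hπ, nabla, w_zpow, hπ, mul_one, ← zpow_add₀ hπ.ne_zero, two_mul]
  simp only [starTransform, fourier, AddChar.mulShift_apply, h, mul_left_comm]

/-! ### Averages over units, the double transform and dilations -/

variable [MeasurableSpace K] [BorelSpace K] (μ : Measure K)

theorem setIntegral_fracIdeal_addChar_of_mem {ψ : AddChar K Circle} {d : ℤ}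
    (hd : HasConductor ψ d) {n : ℤ} {s : K} (hs : s ∈ fracIdeal K (d - n)) :
    ∫ u in fracIdeal K n, (ψ (s * u) : ℂ) ∂μ = μ.real (fracIdeal K n) := by
  rw [setIntegral_congr_fun (g := fun _ => (1 : ℂ)) (measurableSet_fracIdeal n)]
  · simp
  · intro u hu
    have h := mul_mem_fracIdeal hs hu
    rw [sub_add_cancel] at h
    simp only [hd.1 _ h, Circle.coe_one]

variable [μ.IsAddHaarMeasure]

theorem integrableOn_fracIdeal {g : K → ℂ} (hg : Continuous g) (n : ℤ) :
    IntegrableOn g (fracIdeal K n) μ :=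
  hg.continuousOn.integrableOn_compact (isCompact_fracIdeal n)

theorem integrableOn_shell {g : K → ℂ} (hg : Continuous g) (n : ℤ) :
    IntegrableOn g (shell K n) μ :=
  hg.continuousOn.integrableOn_compact (isCompact_shell n)

/-- Orthogonality: `u ↦ ψ (s * u)` is non-trivial on the ball, so a translation inside it multiplies
the integral by `ψ t ≠ 1`. -/
theorem setIntegral_fracIdeal_addChar_of_notMem {ψ : AddChar K Circle} {d : ℤ}
    (hd : HasConductor ψ d) {n : ℤ} {s : K} (hs : s ∉ fracIdeal K (d - n)) :
    ∫ u in fracIdeal K n, (ψ (s * u) : ℂ) ∂μ = 0 := by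
  obtain ⟨t, ht, ht1⟩ := hd.2
  have ht0 : t ≠ 0 := by
    rintro rfl
    exact ht1 (AddChar.map_zero_eq_one ψ)
  simp only [mem_fracIdeal, not_or] at hs
  have ha : s⁻¹ * t ∈ fracIdeal K n := by
    right
    rw [w_mul (inv_ne_zero hs.1) ht0, w_inv]
    rw [mem_fracIdeal_of_ne_zero ht0] at ht
    omega
  have h1 : ∫ u in fracIdeal K n, (ψ (s * u) : ℂ) ∂μ
      = (ψ t : ℂ) * ∫ u in fracIdeal K n, (ψ (s * u) : ℂ) ∂μ := by
    rw [← integral_indicator (measurableSet_fracIdeal n)]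
    conv_lhs => rw [← integral_add_right_eq_self _ (s⁻¹ * t)]
    rw [← integral_const_mul]
    congr 1
    ext u
    by_cases hu : u ∈ fracIdeal K n
    · rw [Set.indicator_of_mem hu, Set.indicator_of_mem ((add_mem_fracIdeal_iff ha).2 hu), mul_add,
        mul_inv_cancel_left₀ hs.1, AddChar.map_add_eq_mul, Circle.coe_mul, mul_comm]
    · rw [Set.indicator_of_notMem hu,
        Set.indicator_of_notMem (mt (add_mem_fracIdeal_iff ha).1 hu), mul_zero]
  have h2 : (1 - (ψ t : ℂ)) * ∫ u in fracIdeal K n, (ψ (s * u) : ℂ) ∂μ = 0 := by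
    rw [sub_mul, one_mul, ← h1, sub_self]
  exact (mul_eq_zero.1 h2).resolve_left fun h => ht1 (Circle.ext (sub_eq_zero.1 h).symm)

/-- The integral of `ψ (s u)` over the units depends only on the valuation of `s` and the conductor
of `ψ`. -/
theorem setIntegral_shell_addChar_eq {ψ₁ ψ₂ : AddChar K Circle} {d : ℤ} (h₁ : HasConductor ψ₁ d)
    (h₂ : HasConductor ψ₂ d) {s₁ s₂ : K} (hs : ∀ n, s₁ ∈ fracIdeal K n ↔ s₂ ∈ fracIdeal K n) :
    ∫ u in shell K 0, (ψ₁ (s₁ * u) : ℂ) ∂μ = ∫ u in shell K 0, (ψ₂ (s₂ * u) : ℂ) ∂μ := by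
  have key : ∀ n : ℤ, ∫ u in fracIdeal K n, (ψ₁ (s₁ * u) : ℂ) ∂μ
      = ∫ u in fracIdeal K n, (ψ₂ (s₂ * u) : ℂ) ∂μ := fun n => by
    by_cases h : s₁ ∈ fracIdeal K (d - n)
    · rw [setIntegral_fracIdeal_addChar_of_mem μ h₁ h,
        setIntegral_fracIdeal_addChar_of_mem μ h₂ ((hs _).1 h)]
    · rw [setIntegral_fracIdeal_addChar_of_notMem μ h₁ h,
        setIntegral_fracIdeal_addChar_of_notMem μ h₂ (mt (hs _).2 h)]
  have c₁ := h₁.continuous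
  have c₂ := h₂.continuous
  rw [shell, setIntegral_sdiff (measurableSet_fracIdeal _)
      (integrableOn_fracIdeal μ (by fun_prop) _) (fracIdeal_anti (by omega)),
    setIntegral_sdiff (measurableSet_fracIdeal _)
      (integrableOn_fracIdeal μ (by fun_prop) _) (fracIdeal_anti (by omega)), key, key]

theorem setIntegral_shell_starKernel_mul_eq {ψ₁ ψ₂ : AddChar K Circle} {d : ℤ}
    (h₁ : HasConductor ψ₁ d) (h₂ : HasConductor ψ₂ d) {π₁ π₂ : K} (hπ₁ : IsPrimeElement π₁)
    (hπ₂ : IsPrimeElement π₂) (a b : K) :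
    ∫ u in shell K 0, starKernel ψ₁ π₁ (a * u) * starKernel ψ₁ π₁ (b * u) ∂μ =
      ∫ u in shell K 0, starKernel ψ₂ π₂ (a * u) * starKernel ψ₂ π₂ (b * u) ∂μ := by
  have c₁ := h₁.continuous
  have c₂ := h₂.continuous
  rw [setIntegral_congr_fun (measurableSet_shell 0)
      fun u hu => starKernel_mul_starKernel_of_mem_shell ψ₁ hπ₁ a b hu,
    setIntegral_congr_fun (measurableSet_shell 0)
      fun u hu => starKernel_mul_starKernel_of_mem_shell ψ₂ hπ₂ a b hu,
    integral_finsetSum _ fun p _ => integrableOn_shell μ (by fun_prop) 0,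
    integral_finsetSum _ fun p _ => integrableOn_shell μ (by fun_prop) 0]
  refine Finset.sum_congr rfl fun p hp => ?_
  rw [Finset.mem_product, Finset.mem_range, Finset.mem_range] at hp
  rw [integral_const_mul, integral_const_mul]
  congr 1
  exact setIntegral_shell_addChar_eq μ h₁ h₂ fun n =>
    zpow_mul_nabla_add_mem_fracIdeal_iff hπ₁ hπ₂ (by omega) (by omega) a b n

theorem integral_comp_mul_of_mem_shell_zero {u : K} (hu : u ∈ shell K 0) {g : K → ℂ}
    (hg : Continuous g) (hc : HasCompactSupport g) : ∫ x, g (u * x) ∂μ = ∫ x, g x ∂μ := by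
  rw [mem_shell] at hu
  rw [integral_comp_mul μ hu.1 hg hc, hu.2, zpow_zero, one_mul]

/-- Averaging an integral over the group of units. -/
theorem measureReal_shell_mul_integral {φ Φ : K → ℂ} (hφ : Continuous φ)
    (hc : HasCompactSupport φ) (hu : ∀ u ∈ shell K 0, ∀ x, φ (u * x) = φ x) (hΦ : Continuous Φ) :
    μ.real (shell K 0) * ∫ x, φ x * Φ x ∂μ =
      ∫ x, φ x * ∫ u in shell K 0, Φ (x * u) ∂μ ∂μ := by
  have hχ : Continuous ((shell K 0).indicator fun _ => (1 : ℂ)) :=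
    (isClopen_shell 0).continuous_indicator continuous_const
  have hswap := integral_integral_swap_of_hasCompactSupport (μ := μ) (ν := μ)
    (f := fun u x : K => (shell K 0).indicator (fun _ => (1 : ℂ)) u * (φ x * Φ (x * u)))
    (by simp only [Function.uncurry_def]; fun_prop)
    (by
      refine HasCompactSupport.intro ((isCompact_shell (K := K) 0).prod hc) ?_
      rintro ⟨u, x⟩ h
      simp only [Set.mem_prod, not_and_or] at h
      simp only [Function.uncurry_apply_pair]
      rcases h with h | h
      · rw [Set.indicator_of_notMem h, zero_mul]
      · rw [image_eq_zero_of_notMem_tsupport h, zero_mul, mul_zero])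
  have hL : ∀ u : K, ∫ x, (shell K 0).indicator (fun _ => (1 : ℂ)) u * (φ x * Φ (x * u)) ∂μ =
      (shell K 0).indicator (fun _ => ∫ x, φ x * Φ x ∂μ) u := fun u => by
    rw [integral_const_mul]
    by_cases h : u ∈ shell K 0
    · rw [Set.indicator_of_mem h, Set.indicator_of_mem h, one_mul,
        -- A unit dilation preserves the measure and `φ`, so each unit gives the same inner
        -- integral.
        ← integral_comp_mul_of_mem_shell_zero μ h (g := fun x => φ x * Φ x) (hφ.mul hΦ)
          hc.mul_right]
      simp only [hu u h]
      simp only [mul_comm u]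
    · rw [Set.indicator_of_notMem h, Set.indicator_of_notMem h, zero_mul]
  have hR : ∀ x : K, ∫ u, (shell K 0).indicator (fun _ => (1 : ℂ)) u * (φ x * Φ (x * u)) ∂μ =
      φ x * ∫ u in shell K 0, Φ (x * u) ∂μ := fun x => by
    rw [← integral_indicator (measurableSet_shell 0), ← integral_const_mul]
    congr 1
    ext u
    by_cases h : u ∈ shell K 0
    · rw [Set.indicator_of_mem h, Set.indicator_of_mem h, one_mul]
    · rw [Set.indicator_of_notMem h, Set.indicator_of_notMem h, zero_mul, mul_zero]
  simp only [hL, hR] at hswap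
  rw [← hswap, integral_indicator (measurableSet_shell 0), setIntegral_const, Complex.real_smul]

theorem integral_mul_starKernel_mul_starKernel_eq {ψ₁ ψ₂ : AddChar K Circle} {d : ℤ}
    (h₁ : HasConductor ψ₁ d) (h₂ : HasConductor ψ₂ d) {π₁ π₂ : K} (hπ₁ : IsPrimeElement π₁)
    (hπ₂ : IsPrimeElement π₂) {φ : K → ℂ} (hφ : Continuous φ) (hc : HasCompactSupport φ)
    (hu : ∀ u ∈ shell K 0, ∀ x, φ (u * x) = φ x) (v y : K) :
    ∫ x, φ x * (starKernel ψ₁ π₁ (v * x) * starKernel ψ₁ π₁ (y * x)) ∂μ =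
      ∫ x, φ x * (starKernel ψ₂ π₂ (v * x) * starKernel ψ₂ π₂ (y * x)) ∂μ := by
  have c₁ := continuous_starKernel h₁.continuous hπ₁
  have c₂ := continuous_starKernel h₂.continuous hπ₂
  have hpos : (μ.real (shell K 0) : ℂ) ≠ 0 := by
    rw [Complex.ofReal_ne_zero]
    exact (ENNReal.toReal_pos ((isClopen_shell 0).2.measure_pos μ
      ⟨1, mem_shell.2 ⟨one_ne_zero, w_one⟩⟩).ne' (isCompact_shell 0).measure_ne_top).ne'
  refine mul_left_cancel₀ hpos ?_
  rw [measureReal_shell_mul_integral μ hφ hc hu (Φ := fun x => starKernel ψ₁ π₁ (v * x) *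
      starKernel ψ₁ π₁ (y * x)) (by fun_prop),
    measureReal_shell_mul_integral μ hφ hc hu (Φ := fun x => starKernel ψ₂ π₂ (v * x) *
      starKernel ψ₂ π₂ (y * x)) (by fun_prop)]
  congr 1
  ext x
  simp only [← mul_assoc]
  rw [setIntegral_shell_starKernel_mul_eq μ h₁ h₂ hπ₁ hπ₂]

/-- The kernel does not decay at infinity. Inserting the indicator of a ball outside which the first
transform vanishes changes nothing and gives the compact support that Fubini needs. -/
theorem doubleStarTransform_eq_integral {ψ : AddChar K Circle} {d : ℤ} (hd : HasConductor ψ d)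
    {π : K} (hπ : IsPrimeElement π) {f : K → ℂ} (hf : f ∈ SchwartzBruhat K) {N : ℤ}
    (hN : ∀ x ∉ fracIdeal K N, starTransform μ ψ π f x = 0) (y : K) :
    doubleStarTransform μ ψ π f y = ∫ v, f v * absValue v *
      ∫ x, (fracIdeal K N).indicator absValue x *
        (starKernel ψ π (v * x) * starKernel ψ π (y * x)) ∂μ ∂μ := by
  have hk := continuous_starKernel hd.continuous hπ
  have hfc : Continuous f := hf.1.continuous
  have ha := continuous_absValue (K := K)
  have hχ : Continuous ((fracIdeal K N).indicator absValue) :=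
    (isClopen_fracIdeal N).continuous_indicator ha
  have hswap := integral_integral_swap_of_hasCompactSupport (μ := μ) (ν := μ)
    (f := fun v x : K => f v * absValue v * ((fracIdeal K N).indicator absValue x *
        (starKernel ψ π (v * x) * starKernel ψ π (y * x))))
    (by simp only [Function.uncurry_def]; fun_prop)
    (by
      refine HasCompactSupport.intro (IsCompact.prod hf.2 (isCompact_fracIdeal (K := K) N)) ?_
      rintro ⟨v, x⟩ h
      simp only [Set.mem_prod, not_and_or] at h
      simp only [Function.uncurry_apply_pair]
      rcases h with h | h
      · rw [image_eq_zero_of_notMem_tsupport h, zero_mul, zero_mul]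
      · rw [Set.indicator_of_notMem h, zero_mul, mul_zero])
  simp only [integral_const_mul] at hswap
  rw [hswap, doubleStarTransform,
    starTransform_eq_integral μ hd.continuous hπ (starTransform_mem_schwartzBruhat μ hd hπ hf)]
  congr 1
  ext x
  by_cases hx : x ∈ fracIdeal K N
  · rw [Set.indicator_of_mem hx, starTransform_eq_integral μ hd.continuous hπ hf, mul_assoc,
      ← integral_mul_const]
    congr 1
    ext v
    rw [mul_comm x y]
    ring
  · rw [hN x hx, Set.indicator_of_notMem hx]
    simp

/-- The double `*`-transform depends on `ψ` and `π` only through the conductor of `ψ`. -/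
theorem doubleStarTransform_eq_of_hasConductor {ψ₁ ψ₂ : AddChar K Circle} {d : ℤ}
    (h₁ : HasConductor ψ₁ d) (h₂ : HasConductor ψ₂ d) {π₁ π₂ : K} (hπ₁ : IsPrimeElement π₁)
    (hπ₂ : IsPrimeElement π₂) {f : K → ℂ} (hf : f ∈ SchwartzBruhat K) :
    doubleStarTransform μ ψ₁ π₁ f = doubleStarTransform μ ψ₂ π₂ f := by
  ext y
  obtain ⟨N₁, hN₁⟩ := hasCompactSupport_iff_fracIdeal.1
    (starTransform_mem_schwartzBruhat μ h₁ hπ₁ hf).2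
  obtain ⟨N₂, hN₂⟩ := hasCompactSupport_iff_fracIdeal.1
    (starTransform_mem_schwartzBruhat μ h₂ hπ₂ hf).2
  -- The smaller index is the larger ball, so both transforms are truncated by the same weight.
  rw [doubleStarTransform_eq_integral μ h₁ hπ₁ hf (N := min N₁ N₂)
      fun x hx => hN₁ x (mt (fun h => fracIdeal_anti (min_le_left _ _) h) hx),
    doubleStarTransform_eq_integral μ h₂ hπ₂ hf (N := min N₁ N₂)
      fun x hx => hN₂ x (mt (fun h => fracIdeal_anti (min_le_right _ _) h) hx)]
  congr 1
  ext v
  rw [integral_mul_starKernel_mul_starKernel_eq μ h₁ h₂ hπ₁ hπ₂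
    ((isClopen_fracIdeal _).continuous_indicator continuous_absValue)
    (hasCompactSupport_indicator (isCompact_fracIdeal _) _)]
  intro u hu x
  rw [mem_shell] at hu
  have hmem : u * x ∈ fracIdeal K (min N₁ N₂) ↔ x ∈ fracIdeal K (min N₁ N₂) := by
    rw [mul_mem_fracIdeal_iff hu.1, hu.2, sub_zero]
  by_cases hx : x ∈ fracIdeal K (min N₁ N₂)
  · rw [Set.indicator_of_mem hx, Set.indicator_of_mem (hmem.2 hx),
      absValue_mul_of_w_eq_zero hu.1 hu.2]
  · rw [Set.indicator_of_notMem hx, Set.indicator_of_notMem (mt hmem.1 hx)]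

/-- The exponent `2 * w a` is `w a` from the change of measure plus `w a` from the weight
`absValue`. -/
theorem starTransform_comp_mul {ψ : AddChar K Circle} (hψ : Continuous ψ) {π : K}
    (hπ : IsPrimeElement π) {a : K} (ha : a ≠ 0) {g : K → ℂ} (hg : g ∈ SchwartzBruhat K) (x : K) :
    starTransform μ ψ π (fun v => g (a * v)) x =
      (Nat.card 𝓀[K] : ℂ) ^ (2 * w a) * starTransform μ ψ π g (a⁻¹ * x) := by
  have hq : (Nat.card 𝓀[K] : ℂ) ≠ 0 := by exact_mod_cast (card_residueField_pos (K := K)).ne'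
  have hk := continuous_starKernel hψ hπ
  have hgc : Continuous g := hg.1.continuous
  have hac := continuous_absValue (K := K)
  rw [starTransform_eq_integral μ hψ hπ (comp_mul_mem_schwartzBruhat ha hg),
    starTransform_eq_integral μ hψ hπ hg, two_mul, zpow_add₀ hq, mul_assoc,
    ← integral_comp_mul μ ha
      (f := fun v => g v * absValue v * starKernel ψ π (v * (a⁻¹ * x))) (by fun_prop)
      hg.2.mul_right.mul_right, ← integral_const_mul]
  congr 1
  ext v
  have habs : absValue (a * v) = (Nat.card 𝓀[K] : ℂ) ^ (-w a) * absValue v := by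
    by_cases hv : v = 0
    · simp [hv, absValue]
    · rw [absValue_of_ne_zero hv, absValue_of_ne_zero (mul_ne_zero ha hv), w_mul ha hv, neg_add,
        zpow_add₀ hq]
  rw [habs, show a * v * (a⁻¹ * x) = v * x by field_simp, zpow_neg]
  field_simp

/-- The outer transform is evaluated at `π ^ e * x`, and dilating its input by `π ^ e` brings the
argument back to `x` at the cost of `q ^ (2 * e)`. -/
theorem doubleStarTransform_mulShift_sq {ψ : AddChar K Circle} {d : ℤ} (hd : HasConductor ψ d)
    {π : K} (hπ : IsPrimeElement π) (e : ℤ) {f : K → ℂ} (hf : f ∈ SchwartzBruhat K) (x : K) :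
    doubleStarTransform μ (ψ.mulShift (π ^ (2 * e))) π f x =
      (Nat.card 𝓀[K] : ℂ) ^ (2 * e) * doubleStarTransform μ ψ π f x := by
  have hne : π ^ e ≠ 0 := zpow_ne_zero _ hπ.ne_zero
  rw [doubleStarTransform, starTransform_mulShift_sq μ ψ hπ,
    show starTransform μ (ψ.mulShift (π ^ (2 * e))) π f =
      fun x => starTransform μ ψ π f (π ^ e * x) from
      funext fun x => starTransform_mulShift_sq μ ψ hπ e f x,
    starTransform_comp_mul μ hd.continuous hπ hne (starTransform_mem_schwartzBruhat μ hd hπ hf),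
    inv_mul_cancel_left₀ hne, w_zpow, hπ, mul_one, doubleStarTransform]

end DoubleTransform

end LocalField

theorem mainTheorem8 {K : Type*} [Field K] [ValuativeRel K] [TopologicalSpace K]
    [IsNonarchimedeanLocalField K] [MeasurableSpace K] [BorelSpace K]
    (μ : Measure K) [μ.IsAddHaarMeasure]
    (ψ : AddChar K Circle) (hψ : Continuous ψ) (hψ_nontrivial : ψ ≠ 1) :
    -- the double transform is defined on the Schwartz–Bruhat space and maps it to itself
    (∀ π : K, LocalField.IsPrimeElement π → ∀ f ∈ LocalField.SchwartzBruhat K,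
      Integrable (LocalField.W π f) μ ∧
        LocalField.starTransform μ ψ π f ∈ LocalField.SchwartzBruhat K) ∧
    -- independence of the prime
    (∀ π₁ π₂ : K, LocalField.IsPrimeElement π₁ → LocalField.IsPrimeElement π₂ →
      ∀ f ∈ LocalField.SchwartzBruhat K,
        LocalField.doubleStarTransform μ ψ π₁ f = LocalField.doubleStarTransform μ ψ π₂ f) ∧
    -- dependence on the character
    (∀ (ψ' : AddChar K Circle), Continuous ψ' → ∀ d d' : ℤ,
      LocalField.HasConductor ψ d → LocalField.HasConductor ψ' d' → d' ≡ d [ZMOD 2] →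
      ∀ π : K, LocalField.IsPrimeElement π → ∀ f ∈ LocalField.SchwartzBruhat K, ∀ x : K,
        LocalField.doubleStarTransform μ ψ' π f x =
          (Nat.card 𝓀[K] : ℂ) ^ (d - d') * LocalField.doubleStarTransform μ ψ π f x) := by
  obtain ⟨c, hc⟩ := LocalField.exists_hasConductor hψ hψ_nontrivial
  refine ⟨fun π hπ f hf => ⟨?_, LocalField.starTransform_mem_schwartzBruhat μ hc hπ hf⟩,
    fun π₁ π₂ h₁ h₂ f hf =>
      LocalField.doubleStarTransform_eq_of_hasConductor μ hc hc h₁ h₂ hf,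
    fun ψ' _ d d' hd hd' hdd π hπ f hf x => ?_⟩
  · have hW := LocalField.W_mem_schwartzBruhat hπ hf
    exact hW.1.continuous.integrable_of_hasCompactSupport hW.2
  -- With `d - d' = 2 * e`, the shift of `ψ` by `π ^ (2 * e)` has the conductor `d'` of `ψ'`, so it
  -- may stand in for `ψ'`.
  · obtain ⟨e, he⟩ := hdd.dvd
    have hcond := LocalField.hasConductor_mulShift hd
      (zpow_ne_zero (2 * e) (LocalField.IsPrimeElement.ne_zero hπ))
    rw [LocalField.w_zpow, hπ, mul_one, show d - 2 * e = d' by omega] at hcond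
    rw [LocalField.doubleStarTransform_eq_of_hasConductor μ hd' hcond hπ hπ hf,
      LocalField.doubleStarTransform_mulShift_sq μ hd hπ e hf, he]
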